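/- For two words $u,v$, write $u\stackrel{e}{\sim}v$ if $|u|=|v|$ and $u$ and $v$ differ at an even number of positions; $w^R$ denotes the reversal of $w$. Problem I is the following promise problem. The input is promised to be of the form $w_1\#w_2\#w_3$ with $w_1,w_2\in\{a,b,c\}^n$ and $w_3\in\{a,b,c,d\}^n$ for some $n\ge 0$. It is a yes-instance if exactly one of $w_1\stackrel{e}{\sim}w_2^R$ and $w_1\stackrel{e}{\sim}w_3^R$ holds, and a no-instance otherwise. A deterministic pushdown automaton has a finite set of states, a finite stack alphabet, a one-way input tape that contains the input between two endmarkers, and a stack that initially holds only a bottom symbol $Z$, which is never popped and never pushed. Its head starts on the left endmarker. In each step, depending on the current state, the scanned tape symbol and the top stack symbol, it changes its state, either pops the top symbol or pushes a (possibly empty) word on the stack, and either moves its head one cell to the right or keeps it in place; it halts, accepting or rejecting, when it enters an accepting or a rejecting state. It solves a promise problem if it accepts every yes-instance and rejects every no-instance; its behaviour on inputs that violate the promise is arbitrary. Theorem. No deterministic pushdown automaton solves Problem I. -/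

import Mathlib

/-- The contents of a cell of the input tape: an endmarker or an input symbol. -/
inductive TapeSymbol (α : Type*) where
  | leftEnd : TapeSymbol α
  | symbol : α → TapeSymbol α
  | rightEnd : TapeSymbol α

/-- A stack operation: pop the top symbol, or push a word on top of it
(pushing the empty word leaves the stack unchanged). -/
inductive StackOp (Γ : Type*) where
  | pop : StackOp Γ
  | push : List Γ → StackOp Γ

/-- A deterministic pushdown automaton with states `Q`, input alphabet `α` and stack alphabet `Γ`.
In state `q`, reading the tape symbol `a` and the stack top `b`, the triple `δ q a b` consists of
the next state, the stack operation, and whether the input head moves one cell to the right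
(`true`) or stays (`false`). -/
structure DPDA (Q α Γ : Type*) where
  /-- the transition function -/
  δ : Q → TapeSymbol α → Γ → Q × StackOp Γ × Bool
  /-- the initial state -/
  q₀ : Q
  /-- the bottom symbol of the stack -/
  Z : Γ
  /-- the accepting states -/
  acc : Set Q
  /-- the rejecting states -/
  rej : Set Q
  disjoint_acc_rej : Disjoint acc rej
  /-- the bottom symbol is never popped -/
  not_pop_bottom : ∀ q a, (δ q a Z).2.1 ≠ StackOp.pop
  /-- the bottom symbol is never pushed -/
  not_push_bottom : ∀ q a b w, (δ q a b).2.1 = StackOp.push w → Z ∉ w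

/-- A configuration: the state, the position of the input head, and the stack contents,
listed from the top to the bottom. -/
structure DPDAConfig (Q Γ : Type*) where
  state : Q
  pos : ℕ
  stack : List Γ

namespace StackOp

/-- The effect of a stack operation on a stack listed from the top to the bottom. A pushed word is
written symbol by symbol, so that its last symbol becomes the new top. -/
def apply {Γ : Type*} : StackOp Γ → List Γ → List Γ
  | pop, s => s.tail
  | push w, s => w.reverse ++ s

end StackOp

namespace DPDA

variable {Q α Γ : Type*}

/-- The input tape: the input word between the two endmarkers. -/
def tape (x : List α) : List (TapeSymbol α) :=
  TapeSymbol.leftEnd :: (x.map TapeSymbol.symbol ++ [TapeSymbol.rightEnd])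

/-- The initial configuration: the head scans the left endmarker (position 0), and the stack
consists of the bottom symbol. -/
def init (M : DPDA Q α Γ) : DPDAConfig Q Γ := ⟨M.q₀, 0, [M.Z]⟩

open Classical in
/-- One step of the computation on input `x`. A configuration does not change any more once its
state is accepting or rejecting. The same holds if the head has run off the tape, in
which case the automaton gives no answer; the stack is never empty in a computation. -/
noncomputable def step (M : DPDA Q α Γ) (x : List α) (c : DPDAConfig Q Γ) : DPDAConfig Q Γ :=
  if c.state ∈ M.acc ∪ M.rej then c
  else
    match (tape x)[c.pos]?, c.stack with
    | some a, b :: s =>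
      let t := M.δ c.state a b
      ⟨t.1, if t.2.2 then c.pos + 1 else c.pos, t.2.1.apply (b :: s)⟩
    | _, _ => c

/-- The configuration after `t` steps on input `x`. -/
noncomputable def run (M : DPDA Q α Γ) (x : List α) (t : ℕ) : DPDAConfig Q Γ :=
  (M.step x)^[t] M.init

/-- `M` halts on `x` in an accepting state. -/
def Accepts (M : DPDA Q α Γ) (x : List α) : Prop := ∃ t, (M.run x t).state ∈ M.acc

/-- `M` halts on `x` in a rejecting state. -/
def Rejects (M : DPDA Q α Γ) (x : List α) : Prop := ∃ t, (M.run x t).state ∈ M.rej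

end DPDA

/-- A promise problem: disjoint sets of yes-instances and no-instances. -/
structure PromiseProblem (α : Type*) where
  yes : Set (List α)
  no : Set (List α)
  disjoint_yes_no : Disjoint yes no

/-- `M` solves a promise problem if it accepts all yes-instances and rejects all no-instances;
its behaviour on other inputs is arbitrary. -/
def DPDA.Solves {Q α Γ : Type*} (M : DPDA Q α Γ) (P : PromiseProblem α) : Prop :=
  (∀ x ∈ P.yes, M.Accepts x) ∧ (∀ x ∈ P.no, M.Rejects x)

/-- The input alphabet of Problem I. -/
inductive Letter where
  | a | b | c | d | hash
  deriving DecidableEq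

/-- The number of positions at which two words (of equal length) differ. -/
def diffCount {α : Type*} [DecidableEq α] (u v : List α) : ℕ :=
  ((Finset.range u.length).filter (fun i => u[i]? ≠ v[i]?)).card

/-- `u` and `v` have even distinctions: they have the same length and differ at an even number of
positions. -/
def EvenDist {α : Type*} [DecidableEq α] (u v : List α) : Prop :=
  u.length = v.length ∧ Even (diffCount u v)

namespace ProblemI

open Letter

/-- The promise of Problem I on the three parts of the input, for words of length `n`. -/
def Promise (n : ℕ) (w₁ w₂ w₃ : List Letter) : Prop :=
  (w₁.length = n ∧ ∀ x ∈ w₁, x = a ∨ x = b ∨ x = c) ∧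
  (w₂.length = n ∧ ∀ x ∈ w₂, x = a ∨ x = b ∨ x = c) ∧
  (w₃.length = n ∧ ∀ x ∈ w₃, x = a ∨ x = b ∨ x = c ∨ x = d)

/-- The input word `w₁ # w₂ # w₃`. -/
def input (w₁ w₂ w₃ : List Letter) : List Letter := w₁ ++ hash :: (w₂ ++ hash :: w₃)

/-- The question asked by Problem I. -/
def Question (w₁ w₂ w₃ : List Letter) : Prop :=
  Xor (EvenDist w₁ w₂.reverse) (EvenDist w₁ w₃.reverse)

/-- A word is cut uniquely at the first occurrence of a separator. -/
theorem append_cons_inj {α : Type*} {s : α} {u u' v v' : List α} (hu : s ∉ u) (hu' : s ∉ u')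
    (h : u ++ s :: v = u' ++ s :: v') : u = u' ∧ v = v' := by
  induction u generalizing u' with
  | nil =>
    cases u' with
    | nil => exact ⟨rfl, (List.cons.inj h).2⟩
    | cons y u' => exact absurd (List.mem_cons.2 (Or.inl (List.cons.inj h).1)) hu'
  | cons x u ih =>
    cases u' with
    | nil => exact absurd (List.mem_cons.2 (Or.inl (List.cons.inj h).1.symm)) hu
    | cons y u' =>
      simp only [List.cons_append, List.cons.injEq, List.mem_cons, not_or] at h hu hu'
      obtain ⟨h1, h2⟩ := ih hu.2 hu'.2 h.2
      exact ⟨by rw [h.1, h1], h2⟩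

end ProblemI

/-- Problem I. -/
def problemI : PromiseProblem Letter where
  yes := {x | ∃ n w₁ w₂ w₃, ProblemI.Promise n w₁ w₂ w₃ ∧
    x = ProblemI.input w₁ w₂ w₃ ∧ ProblemI.Question w₁ w₂ w₃}
  no := {x | ∃ n w₁ w₂ w₃, ProblemI.Promise n w₁ w₂ w₃ ∧
    x = ProblemI.input w₁ w₂ w₃ ∧ ¬ ProblemI.Question w₁ w₂ w₃}
  disjoint_yes_no := by
    rw [Set.disjoint_left]
    rintro x ⟨n, u₁, u₂, u₃, hu, rfl, hq⟩ ⟨m, v₁, v₂, v₃, hv, he, hq'⟩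
    have key : ∀ w : List Letter, (∀ x ∈ w, x = Letter.a ∨ x = Letter.b ∨ x = Letter.c) →
        Letter.hash ∉ w := by
      intro w hw hm
      rcases hw _ hm with h | h | h <;> cases h
    obtain ⟨h1, h2⟩ := ProblemI.append_cons_inj (key _ hu.1.2) (key _ hv.1.2) he
    obtain ⟨h3, h4⟩ := ProblemI.append_cons_inj (key _ hu.2.1.2) (key _ hv.2.1.2) h2
    subst h1 h3 h4
    exact hq' hq

/-! Call the state, scanned symbol and stack top together a type. At a point of minimal stack height
the current top is not popped by any continuation over `{a, b, c}`, and by finiteness some such type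
`τ` is recurrent: two words `aA` and `bB` of equal length lead from `τ` back to `τ`
(`exists_leads_loops`). Take first words `x e e'`, where `e` consists of `m` such loops and `e'` of
`2m`. They pass through `τ` between `e` and `e'`, and `e` stays hidden below the stack top of `τ`
until that top is popped.

If the pop occurs while the second word is read, then afterwards only the state and the head
position carry information on `e'`. The third word can still ask about `e'`, so for a fixed second
word these data determine `e'` (`eq_of_pop`). For `2 ^ m` second words together they take fewer than
`2 ^ (2m)` values, so some `e'` causes no pop on any of these second words.

With this `e'` and a fixed third word, the computation either halts without access to `e` or pops
inside the third word (`exists_reach_halt_or_pop`). The possible states and positions number fewer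
than `2 ^ m`, so two second words give the same outcome for every `e`. Yet some `e` has distances of
different parity to them (`exists_odd_diffCount_ne`), so the answers must differ. -/

open Relation List

/-! ### Computations on pieces of the tape and of the stack -/

namespace DPDA

variable {Q α Γ : Type*}

/-- One step on a configuration that is given by the state, the unread part of the tape (beginning
with the scanned cell) and the stack. No step is possible in a halting state, at the end of the
tape, or on an empty stack. -/
inductive Step (M : DPDA Q α Γ) : Q × List (TapeSymbol α) × List Γ →
    Q × List (TapeSymbol α) × List Γ → Prop
  | mk {q a u b s} (hq : q ∉ M.acc ∪ M.rej) :
      Step M (q, a :: u, b :: s)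
        ((M.δ q a b).1, if (M.δ q a b).2.2 then u else a :: u, (M.δ q a b).2.1.apply (b :: s))

/-- Reachability in any number of steps. -/
abbrev Reach (M : DPDA Q α Γ) := ReflTransGen M.Step

variable {M : DPDA Q α Γ}

theorem _root_.StackOp.apply_append (o : StackOp Γ) (b : Γ) (s r : List Γ) :
    o.apply (b :: s ++ r) = o.apply (b :: s) ++ r := by
  cases o <;> simp [StackOp.apply]

theorem Step.append {q q' u u' s s'} (h : M.Step (q, u, s) (q', u', s'))
    (v : List (TapeSymbol α)) (r : List Γ) : M.Step (q, u ++ v, s ++ r) (q', u' ++ v, s' ++ r) := by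
  cases h with
  | mk hq =>
    rename_i a u b s
    have h : (if (M.δ q a b).2.2 then u else a :: u) ++ v =
        if (M.δ q a b).2.2 then u ++ v else a :: (u ++ v) := by split <;> rfl
    rw [← StackOp.apply_append, h]
    exact .mk hq

theorem Reach.append {q q' u u' s s'} (h : M.Reach (q, u, s) (q', u', s'))
    (v : List (TapeSymbol α)) (r : List Γ) :
    M.Reach (q, u ++ v, s ++ r) (q', u' ++ v, s' ++ r) :=
  ReflTransGen.lift (fun c : Q × List (TapeSymbol α) × List Γ => (c.1, c.2.1 ++ v, c.2.2 ++ r))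
    (fun _ _ h => h.append v r) _ _ h

theorem Step.unique {c d e} (h : M.Step c d) (h' : M.Step c e) : d = e := by
  cases h
  cases h'
  rfl

theorem Reach.total {c d e} (h : M.Reach c d) (h' : M.Reach c e) : M.Reach d e ∨ M.Reach e d :=
  ReflTransGen.total_of_right_unique (fun _ _ _ => Step.unique) h h'

theorem not_step_of_halt {c d} (hc : c.1 ∈ M.acc ∪ M.rej) : ¬ M.Step c d := by
  rintro ⟨hq⟩
  exact hq hc

theorem not_step_of_tape_nil {q s d} : ¬ M.Step (q, [], s) d := nofun

theorem not_step_of_stack_nil {q u d} : ¬ M.Step (q, u, []) d := nofun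

theorem Reach.eq_of_terminal {c d} (hc : ∀ e, ¬ M.Step c e) (h : M.Reach c d) : d = c := by
  rcases ReflTransGen.cases_head h with h | ⟨e, he, -⟩
  · exact h.symm
  · exact (hc e he).elim

theorem Reach.of_terminal {c d e} (he : ∀ f, ¬ M.Step e f) (h : M.Reach c d) (h' : M.Reach c e) :
    M.Reach d e := by
  rcases h.total h' with h | h
  · exact h
  · rw [h.eq_of_terminal he]

theorem Step.isSuffix {c d} (h : M.Step c d) : d.2.1 <:+ c.2.1 := by
  cases h
  dsimp only
  split
  · exact suffix_cons _ _
  · exact suffix_rfl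

theorem Reach.isSuffix {c d} (h : M.Reach c d) : d.2.1 <:+ c.2.1 := by
  induction h with
  | refl => exact suffix_rfl
  | tail _ h ih => exact h.isSuffix.trans ih

/-- A computation on a tape `u ++ v` stays within `u` or reads `u` completely. -/
theorem Reach.tape_split {q u v s d} (h : M.Reach (q, u ++ v, s) d) :
    (∃ q' u' s', d = (q', u' ++ v, s') ∧ M.Reach (q, u, s) (q', u', s')) ∨
    ∃ q' s', M.Reach (q, u, s) (q', [], s') ∧ M.Reach (q', v, s') d := by
  induction h with
  | refl => exact .inl ⟨_, _, _, rfl, .refl⟩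
  | tail _ hs ih =>
    rcases ih with ⟨q', u', s', rfl, h'⟩ | ⟨q', s', h1, h2⟩
    · rcases u' with _ | ⟨a, u'⟩
      · exact .inr ⟨_, _, h', .single hs⟩
      · cases hs with
        | mk hq =>
          rename_i b s'
          refine .inl ⟨_, _, _, ?_, h'.tail (.mk hq)⟩
          split <;> simp
    · exact .inr ⟨_, _, h1, h2.tail hs⟩

/-- A computation on a stack `s ++ r` leaves `r` untouched or pops `s` completely. -/
theorem Reach.stack_split {q u s r d} (h : M.Reach (q, u, s ++ r) d) :
    (∃ q' u' s', d = (q', u', s' ++ r) ∧ M.Reach (q, u, s) (q', u', s')) ∨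
    ∃ q' u', M.Reach (q, u, s) (q', u', []) ∧ M.Reach (q', u', r) d := by
  induction h with
  | refl => exact .inl ⟨_, _, _, rfl, .refl⟩
  | tail _ hs ih =>
    rcases ih with ⟨q', u', s', rfl, h'⟩ | ⟨q', s', h1, h2⟩
    · rcases s' with _ | ⟨b, s'⟩
      · exact .inr ⟨_, _, h', .single hs⟩
      · cases hs with
        | mk hq =>
          refine .inl ⟨_, _, _, ?_, h'.tail (.mk hq)⟩
          rw [← StackOp.apply_append]
          rfl
    · exact .inr ⟨_, _, h1, h2.tail hs⟩

/-- Cells to the right of the head have not been scanned, so they cannot have influenced the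
computation. -/
theorem Reach.truncate {q u v s q' y s'} (h : M.Reach (q, u ++ v, s) (q', y :: v, s')) :
    M.Reach (q, u, s) (q', [y], s') := by
  rcases h.tape_split with ⟨q₁, u₁, s₁, he, h'⟩ | ⟨q₁, s₁, -, h'⟩
  · simp only [Prod.mk.injEq] at he
    obtain ⟨rfl, he, rfl⟩ := he
    have : [y] ++ v = u₁ ++ v := he
    rwa [append_cancel_right this]
  · have := h'.isSuffix.length_le
    simp at this

/-- The bottom symbol always stays on the stack. -/
theorem Reach.bottom_isSuffix {q u d} (h : M.Reach (q, u, [M.Z]) d) : [M.Z] <:+ d.2.2 := by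
  induction h with
  | refl => exact suffix_rfl
  | tail _ hs ih =>
    cases hs with
    | @mk q a u b s hq =>
      dsimp only at ih ⊢
      obtain ⟨t, ht⟩ := ih
      rcases ho : (M.δ q a b).2.1 with _ | w
      · rcases t with _ | ⟨b', t⟩
        · simp only [nil_append, cons.injEq] at ht
          obtain ⟨rfl, rfl⟩ := ht
          exact (M.not_pop_bottom _ _ ho).elim
        · simp only [cons_append, cons.injEq] at ht
          exact ⟨t, by simp [StackOp.apply, ht.2]⟩
      · exact ⟨w.reverse ++ t, by simp [StackOp.apply, ht]⟩

theorem reach_run (M : DPDA Q α Γ) (x : List α) (t : ℕ) :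
    M.Reach (M.q₀, tape x, [M.Z])
      ((M.run x t).state, (tape x).drop (M.run x t).pos, (M.run x t).stack) := by
  induction t with
  | zero => exact .refl
  | succ t ih =>
    have hr : M.run x (t + 1) = M.step x (M.run x t) := Function.iterate_succ_apply' _ _ _
    rw [hr]
    set c := M.run x t
    unfold step
    split_ifs with hc
    · exact ih
    · split
      · rename_i a b s ha hs
        obtain ⟨hlt, rfl⟩ := List.getElem?_eq_some_iff.1 ha
        rw [hs, drop_eq_getElem_cons hlt] at ih
        have := ih.tail (.mk hc)
        convert this using 3
        dsimp only
        split
        · rfl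
        · exact drop_eq_getElem_cons hlt
      · exact ih

theorem Accepts.reach {x : List α} (h : M.Accepts x) :
    ∃ d, M.Reach (M.q₀, tape x, [M.Z]) d ∧ d.1 ∈ M.acc :=
  h.elim fun t ht => ⟨_, M.reach_run x t, ht⟩

theorem Rejects.reach {x : List α} (h : M.Rejects x) :
    ∃ d, M.Reach (M.q₀, tape x, [M.Z]) d ∧ d.1 ∈ M.rej :=
  h.elim fun t ht => ⟨_, M.reach_run x t, ht⟩

/-! ### Types and transitions between them -/

/-- The tape cells that hold a word. -/
abbrev cells (w : List α) : List (TapeSymbol α) := w.map TapeSymbol.symbol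

/-- Reading the word `w`, the automaton gets from state `τ.1`, scanned symbol `τ.2.1` and stack top
`τ.2.2` to those of `τ'`, without popping the original stack top. -/
def Leads (M : DPDA Q α Γ) (w : List α) (τ τ' : Q × TapeSymbol α × Γ) : Prop :=
  ∃ s, M.Reach (τ.1, τ.2.1 :: cells w, [τ.2.2]) (τ'.1, [τ'.2.1], τ'.2.2 :: s)

theorem Leads.refl (τ : Q × TapeSymbol α × Γ) : M.Leads [] τ τ := ⟨[], .refl⟩

theorem Leads.trans {w w' : List α} {τ τ' τ'' : Q × TapeSymbol α × Γ} (h : M.Leads w τ τ')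
    (h' : M.Leads w' τ' τ'') : M.Leads (w ++ w') τ τ'' := by
  obtain ⟨s, h⟩ := h
  obtain ⟨s', h'⟩ := h'
  refine ⟨s' ++ s, ?_⟩
  have h1 := h.append (cells w') []
  have h2 := h'.append [] s
  simp only [append_nil, cons_append, nil_append, map_append] at h1 h2 ⊢
  exact h1.trans h2

theorem Leads.flatMap {τ : Q × TapeSymbol α × Γ} {β : Type*} {f : β → List α}
    (h : ∀ i, M.Leads (f i) τ τ) (t : List β) : M.Leads (t.flatMap f) τ τ := by
  induction t with
  | nil => exact .refl τ
  | cons i t ih => exact (h i).trans ih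

/-- The stack top is never popped while words from `L` are being read. -/
def Stable (M : DPDA Q α Γ) (L : Set (List α)) (τ : Q × TapeSymbol α × Γ) : Prop :=
  ∀ w ∈ L, ∀ q u, ¬ M.Reach (τ.1, τ.2.1 :: cells w, [τ.2.2]) (q, u, [])

end DPDA

instance {α : Type*} [Finite α] : Finite (TapeSymbol α) := by
  refine Finite.of_injective (β := Option (Option α))
    (fun x => match x with
      | .leftEnd => none
      | .rightEnd => some none
      | .symbol x => some (some x)) ?_
  rintro (_ | _ | _) (_ | _ | _) h <;> simp_all

instance : Finite Letter :=
  Set.finite_univ_iff.1 (Set.Finite.subset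
    (Set.toFinite {Letter.a, Letter.b, Letter.c, Letter.d, Letter.hash})
    (by rintro (_ | _ | _ | _ | _) - <;> simp))

/-- A transitive relation on a finite type has an element, in any given nonempty set, that is
reached again from everything in the set that it reaches. -/
theorem exists_recurrent {T : Type*} [Finite T] {r : T → T → Prop} (hr : ∀ x, r x x)
    (ht : ∀ x y z, r x y → r y z → r x z) {S : Set T} (hS : S.Nonempty) :
    ∃ x ∈ S, ∀ y ∈ S, r x y → r y x := by
  -- Choose an element that reaches as few elements as possible.
  obtain ⟨x, hx, hmin⟩ := (measure fun x => {y | r x y}.ncard).wf.has_min S hS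
  refine ⟨x, hx, fun y hy hxy => ?_⟩
  have hsub : {z | r y z} ⊆ {z | r x z} := fun z hz => ht _ _ _ hxy hz
  have := Set.eq_of_subset_of_ncard_le hsub (not_lt.1 (hmin y hy)) (Set.toFinite _)
  exact this.symm.subset (hr x)

/-! ### Parity of distances and block codes -/

section diffCount

variable {α : Type*} [DecidableEq α]

@[simp]
theorem diffCount_nil (v : List α) : diffCount [] v = 0 := by simp [diffCount]

theorem diffCount_cons (x y : α) (u v : List α) :
    diffCount (x :: u) (y :: v) = (if x = y then 0 else 1) + diffCount u v := by
  simp only [diffCount, Finset.card_filter, List.length_cons, Finset.sum_range_succ']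
  simp [add_comm]

theorem diffCount_append {u v : List α} (h : u.length = v.length) (u' v' : List α) :
    diffCount (u ++ u') (v ++ v') = diffCount u v + diffCount u' v' := by
  induction u generalizing v with
  | nil => cases v <;> simp_all
  | cons x u ih =>
    cases v with
    | nil => simp at h
    | cons y v =>
      simp only [cons_append, diffCount_cons, ih (Nat.succ.inj h), add_assoc]

end diffCount

namespace ProblemI

open DPDA

/-- The words over `{a, b, c}`. -/
def ABC : Set (List Letter) := {w | ∀ x ∈ w, x = .a ∨ x = .b ∨ x = .c}

theorem nil_mem_ABC : [] ∈ ABC := by simp [ABC]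

theorem cons_mem_ABC {x w} : x :: w ∈ ABC ↔ (x = .a ∨ x = .b ∨ x = .c) ∧ w ∈ ABC := by
  simp [ABC]

theorem append_mem_ABC {v w} : v ++ w ∈ ABC ↔ v ∈ ABC ∧ w ∈ ABC := by
  simp only [ABC, Set.mem_ofPred_eq, mem_append, or_imp, forall_and]

theorem reverse_mem_ABC {w} : w.reverse ∈ ABC ↔ w ∈ ABC := by simp [ABC]

theorem replicate_mem_ABC (n : ℕ) : replicate n Letter.a ∈ ABC := by
  intro x hx
  exact .inl (eq_of_mem_replicate hx)

theorem take_mem_ABC {w} (hw : w ∈ ABC) (n : ℕ) : w.take n ∈ ABC :=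
  fun x hx => hw x (mem_of_mem_take hx)

theorem promise_of_mem_ABC {w₁ w₂ w₃ : List Letter} (h₁ : w₁ ∈ ABC) (h₂ : w₂ ∈ ABC) (h₃ : w₃ ∈ ABC)
    (h₁₂ : w₂.length = w₁.length) (h₁₃ : w₃.length = w₁.length) :
    Promise w₁.length w₁ w₂.reverse w₃.reverse :=
  ⟨⟨rfl, h₁⟩, ⟨by simpa, reverse_mem_ABC.2 h₂⟩, ⟨by simpa, fun x hx => by
    rcases reverse_mem_ABC.2 h₃ x hx with h | h | h <;> simp [h]⟩⟩

theorem question_reverse_iff {w₁ w₂ w₃ : List Letter} (h₁₂ : w₂.length = w₁.length)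
    (h₁₃ : w₃.length = w₁.length) :
    Question w₁ w₂.reverse w₃.reverse ↔ Odd (diffCount w₁ w₂ + diffCount w₁ w₃) := by
  simp only [Question, EvenDist, reverse_reverse, h₁₂, h₁₃, true_and, xor_def,
    ← Nat.not_even_iff_odd, Nat.even_add]
  tauto

/-- A word that differs from two given words with a prescribed parity of the total distance. -/
theorem exists_odd_diffCount_iff (p : Prop) {x y : List Letter} (hx : x ∈ ABC) (hy : y ∈ ABC)
    (hl : x.length = y.length) (hne : x ≠ y) :
    ∃ v ∈ ABC, v.length = x.length ∧ (Odd (diffCount x v + diffCount y v) ↔ p) := by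
  induction x generalizing y with
  | nil => cases y <;> simp_all
  | cons s x ih =>
    obtain _ | ⟨t, y⟩ := y
    · simp at hl
    rw [cons_mem_ABC] at hx hy
    have hl' : x.length = y.length := by simpa using hl
    by_cases hst : s = t
    · obtain ⟨v, hv, hvl, hp⟩ := ih hx.2 hy.2 hl' (fun h => hne (by rw [hst, h]))
      refine ⟨s :: v, cons_mem_ABC.2 ⟨hx.1, hv⟩, by simp [hvl], ?_⟩
      rw [diffCount_cons, diffCount_cons, ← hp, hst]
      simp
    -- At the first difference, the letter `s` contributes 1 to the total distance and the third
    -- letter of the alphabet contributes 2, so either parity is available.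
    · have key : ∀ e : ℕ, e < 2 → ∃ z, (z = Letter.a ∨ z = .b ∨ z = .c) ∧
          (if s = z then 0 else 1) + (if t = z then 0 else 1) = e + 1 := by
        intro e he
        have h1 := hx.1
        have h2 := hy.1
        interval_cases e
        · exact ⟨s, h1, by simp [Ne.symm hst]⟩
        · rcases h1 with rfl | rfl | rfl <;> rcases h2 with rfl | rfl | rfl <;>
            first
            | exact (hst rfl).elim
            | exact ⟨.a, .inl rfl, rfl⟩
            | exact ⟨.b, .inr (.inl rfl), rfl⟩
            | exact ⟨.c, .inr (.inr rfl), rfl⟩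
      have : ∃ e < 2, (Odd (e + 1 + (diffCount x x + diffCount y x)) ↔ p) := by
        by_cases h : Odd (1 + (diffCount x x + diffCount y x)) ↔ p
        · exact ⟨0, by simp, by simpa using h⟩
        · refine ⟨1, by simp, ?_⟩
          rw [add_assoc 1 1, add_comm 1, Nat.odd_add_one]
          tauto
      obtain ⟨e, he, hp⟩ := this
      obtain ⟨z, hz, hze⟩ := key e he
      refine ⟨z :: x, cons_mem_ABC.2 ⟨hz, hx.2⟩, by simp, ?_⟩
      rw [diffCount_cons, diffCount_cons, ← hp, ← hze]
      exact iff_of_eq (congrArg Odd (by omega))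

/-- The codes of two different bit strings are told apart by the parity of their distance from some
concatenation of the words `aA` and `bB`. -/
theorem exists_odd_diffCount_ne {A B : List Letter} {k : ℕ} (hA : A.length = k) (hB : B.length = k)
    {t t' : List Bool} (hl : t.length = t'.length) (hne : t ≠ t') :
    ∃ e : List Bool, e.length = t.length ∧
      ¬ (Odd (diffCount (e.flatMap fun i => bif i then .a :: A else .b :: B)
          (t.flatMap fun i => (bif i then .a else .c) :: replicate k .a)) ↔
        Odd (diffCount (e.flatMap fun i => bif i then .a :: A else .b :: B)
          (t'.flatMap fun i => (bif i then .a else .c) :: replicate k .a))) := by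
  induction t generalizing t' with
  | nil => cases t' <;> simp_all
  | cons i t ih =>
    obtain _ | ⟨i', t'⟩ := t'
    · simp at hl
    have hblock : ∀ e i : Bool, (bif e then Letter.a :: A else .b :: B).length =
        ((bif i then Letter.a else .c) :: replicate k Letter.a).length := by
      rintro (_ | _) i <;> simp [hA, hB]
    by_cases ht : t = t'
    · subst ht
      have hi : i ≠ i' := fun h => hne (by rw [h])
      -- Only the first letters of the blocks matter. `aA` meets `a` or `c` and so detects the bit,
      -- while `bB` differs from both. The word `e` detects the last position where the bit strings
      -- differ: `false` before it, `true` at it, and arbitrary after it.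
      refine ⟨replicate (t.length + 1) true, by simp, ?_⟩
      rw [replicate_succ]
      simp only [flatMap_cons]
      rw [diffCount_append (hblock _ _), diffCount_append (hblock _ _)]
      cases i <;> cases i' <;> simp_all [diffCount_cons, Nat.odd_iff] <;> omega
    · obtain ⟨e, he, h⟩ := ih (by simpa using hl) ht
      refine ⟨false :: e, by simp [he], ?_⟩
      simp only [flatMap_cons]
      rw [diffCount_append (hblock _ _), diffCount_append (hblock _ _)]
      cases i <;> cases i' <;> simp [diffCount_cons, Nat.odd_iff] at h ⊢ <;> omega

theorem flatMap_mem_ABC {f : Bool → List Letter} (h : ∀ i, f i ∈ ABC) (t : List Bool) :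
    t.flatMap f ∈ ABC := by
  intro x hx
  obtain ⟨i, -, hx⟩ := mem_flatMap.1 hx
  exact h i x hx

theorem length_flatMap_of_forall {β γ : Type*} {f : β → List γ} {k : ℕ}
    (h : ∀ i, (f i).length = k) (t : List β) : (t.flatMap f).length = t.length * k := by
  simp [length_flatMap, h]

theorem flatMap_injective_of_forall {β γ : Type*} {f : β → List γ} {k : ℕ}
    (h : ∀ i, (f i).length = k) (hf : Function.Injective f) {t t' : List β}
    (hl : t.length = t'.length) (he : t.flatMap f = t'.flatMap f) : t = t' := by
  induction t generalizing t' with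
  | nil => cases t' <;> simp_all
  | cons i t ih =>
    obtain _ | ⟨i', t'⟩ := t'
    · simp at hl
    obtain ⟨h1, h2⟩ := append_inj he ((h i).trans (h i').symm)
    rw [hf h1, ih (by simpa using hl) h2]

/-! ### Loops of a machine that solves Problem I -/

section Machine

variable {Q Γ : Type*} {M : DPDA Q Letter Γ}

/-- The initial configuration on `w₁ # w₂ᴿ # w₃ᴿ`. -/
def start (M : DPDA Q Letter Γ) (w₁ w₂ w₃ : List Letter) :
    Q × List (TapeSymbol Letter) × List Γ :=
  (M.q₀, .leftEnd :: cells w₁ ++ (.symbol .hash :: cells w₂.reverse ++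
    (.symbol .hash :: cells w₃.reverse ++ [.rightEnd])), [M.Z])

theorem exists_reach_halt (hM : M.Solves problemI) {w₁ w₂ w₃ : List Letter} (h₁ : w₁ ∈ ABC)
    (h₂ : w₂ ∈ ABC) (h₃ : w₃ ∈ ABC) (h₁₂ : w₂.length = w₁.length) (h₁₃ : w₃.length = w₁.length) :
    ∃ d, M.Reach (start M w₁ w₂ w₃) d ∧ d.1 ∈ M.acc ∪ M.rej ∧
      (d.1 ∈ M.acc ↔ Odd (diffCount w₁ w₂ + diffCount w₁ w₃)) := by
  have hP := promise_of_mem_ABC h₁ h₂ h₃ h₁₂ h₁₃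
  have he : start M w₁ w₂ w₃ =
      (M.q₀, tape (input w₁ w₂.reverse w₃.reverse), [M.Z]) := by
    simp [start, tape, input, cells]
  rw [he, ← question_reverse_iff h₁₂ h₁₃]
  by_cases hq : Question w₁ w₂.reverse w₃.reverse
  · obtain ⟨d, hd, ha⟩ := (hM.1 _ ⟨_, _, _, _, hP, rfl, hq⟩).reach
    exact ⟨d, hd, .inl ha, iff_of_true ha hq⟩
  · obtain ⟨d, hd, ha⟩ := (hM.2 _ ⟨_, _, _, _, hP, rfl, hq⟩).reach
    exact ⟨d, hd, .inr ha, iff_of_false (Set.disjoint_right.1 M.disjoint_acc_rej ha) hq⟩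

/-- The answers agree if the computations reach the same halting state or the same
configuration. -/
theorem odd_iff_odd_of_reach (hM : M.Solves problemI) {w₁ w₂ w₃ v₁ v₂ v₃ : List Letter}
    (h₁ : w₁ ∈ ABC) (h₂ : w₂ ∈ ABC) (h₃ : w₃ ∈ ABC)
    (h₁₂ : w₂.length = w₁.length) (h₁₃ : w₃.length = w₁.length)
    (h₁' : v₁ ∈ ABC) (h₂' : v₂ ∈ ABC) (h₃' : v₃ ∈ ABC)
    (h₁₂' : v₂.length = v₁.length) (h₁₃' : v₃.length = v₁.length)
    {q u s u' s'} (hw : M.Reach (start M w₁ w₂ w₃) (q, u, s))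
    (hv : M.Reach (start M v₁ v₂ v₃) (q, u', s'))
    (h : q ∈ M.acc ∪ M.rej ∨ u = u' ∧ s = s') :
    Odd (diffCount w₁ w₂ + diffCount w₁ w₃) ↔ Odd (diffCount v₁ v₂ + diffCount v₁ v₃) := by
  obtain ⟨d, hd, hh, hw'⟩ := exists_reach_halt hM h₁ h₂ h₃ h₁₂ h₁₃
  obtain ⟨e, he, hh', hv'⟩ := exists_reach_halt hM h₁' h₂' h₃' h₁₂' h₁₃'
  replace hd := hw.of_terminal (fun _ => not_step_of_halt hh) hd
  replace he := hv.of_terminal (fun _ => not_step_of_halt hh') he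
  rw [← hw', ← hv']
  rcases h with h | ⟨rfl, rfl⟩
  · rw [hd.eq_of_terminal fun _ => not_step_of_halt h,
      he.eq_of_terminal fun _ => not_step_of_halt h]
  · rw [(hd.of_terminal (fun _ => not_step_of_halt hh') he).eq_of_terminal
      fun _ => not_step_of_halt hh]

/-- A machine that halted inside `x`, or never left it, could not tell apart two inputs that start
with `x` and have different answers. -/
theorem exists_reach_tape_nil (hM : M.Solves problemI) {x : List Letter} (hx : x ∈ ABC) :
    ∃ q s, M.Reach (M.q₀, .leftEnd :: cells x, [M.Z]) (q, [], s) := by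
  set w := x ++ [Letter.a] with hw
  have hwA : w ∈ ABC := append_mem_ABC.2 ⟨hx, replicate_mem_ABC 1⟩
  set v := x ++ [Letter.b] with hv
  have hvA : v ∈ ABC := append_mem_ABC.2 ⟨hx, by simp [ABC]⟩
  have hl : v.length = w.length := by simp [hw, hv]
  have hs : ∀ y, ∃ V, start M w y w = (M.q₀, (.leftEnd :: cells x) ++ V, [M.Z]) :=
    fun y => ⟨_, by simp [start, hw, cells]; rfl⟩
  obtain ⟨d, hd, hdh, -⟩ := exists_reach_halt hM hwA hwA hwA rfl rfl
  obtain ⟨e, he, heh, -⟩ := exists_reach_halt hM hwA hvA hwA hl rfl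
  obtain ⟨V, hV⟩ := hs w
  obtain ⟨V', hV'⟩ := hs v
  have hd' := hd
  have he' := he
  rw [hV] at hd'
  rw [hV'] at he'
  rcases hd'.tape_split with ⟨q₁, u₁, s₁, rfl, h₁⟩ | ⟨q₁, s₁, h₁, -⟩
  swap
  · exact ⟨_, _, h₁⟩
  rcases he'.tape_split with ⟨q₂, u₂, s₂, rfl, h₂⟩ | ⟨q₂, s₂, h₂, -⟩
  swap
  · exact ⟨_, _, h₂⟩
  have := (h₁.of_terminal (fun _ => not_step_of_halt (c := (q₂, u₂, s₂)) heh) h₂).eq_of_terminal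
    fun _ => not_step_of_halt (c := (q₁, u₁, s₁)) hdh
  simp only [Prod.mk.injEq] at this
  obtain ⟨rfl, rfl, rfl⟩ := this
  have := odd_iff_odd_of_reach hM hwA hwA hwA rfl rfl hwA hvA hwA hl rfl hd he (.inl hdh)
  rw [hw, hv, diffCount_append rfl, diffCount_append rfl] at this
  simp [diffCount_cons, Nat.odd_iff] at this
  omega

/-- The initial state and stack top, with the head on the left endmarker. -/
def startType (M : DPDA Q Letter Γ) : Q × TapeSymbol Letter × Γ := (M.q₀, .leftEnd, M.Z)

/-- The bottom symbol is never popped; this starts the search for stable types. -/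
theorem stable_startType : M.Stable ABC (startType M) := fun w _ q u h => by
  simpa using h.bottom_isSuffix

theorem exists_reach_tape_nil_of_stable (hM : M.Solves problemI) {τ : Q × TapeSymbol Letter × Γ}
    (hτ : M.Stable ABC τ) {x w : List Letter} (hx : x ∈ ABC) (hw : w ∈ ABC)
    (h : M.Leads x (startType M) τ) :
    ∃ q s, M.Reach (τ.1, τ.2.1 :: cells w, [τ.2.2]) (q, [], s) := by
  obtain ⟨q, s, hq⟩ := exists_reach_tape_nil hM (append_mem_ABC.2 ⟨hx, hw⟩)
  obtain ⟨r, hr⟩ := h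
  have h1 := hr.append (cells w) []
  simp only [append_nil, startType, cons_append, nil_append, ← map_append] at h1
  have h2 := h1.of_terminal (fun _ => not_step_of_tape_nil) hq
  rcases Reach.stack_split (s := [τ.2.2]) h2 with ⟨q', u', s', he, h⟩ | ⟨q', u', h, -⟩
  · simp only [Prod.mk.injEq] at he
    obtain ⟨rfl, rfl, rfl⟩ := he
    exact ⟨_, _, h⟩
  · exact (hτ w hw _ _ h).elim

/-- Among all configurations that scan the last letter of some `y :: w`, take one of minimal stack
height. A continuation that popped its top would yield a lower one. -/
theorem exists_leads_stable (hM : M.Solves problemI) {τ : Q × TapeSymbol Letter × Γ}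
    (hτ : M.Stable ABC τ) {x : List Letter} (hx : x ∈ ABC) (h : M.Leads x (startType M) τ)
    {y : Letter} (hy : y = .a ∨ y = .b ∨ y = .c) :
    ∃ w, y :: w ∈ ABC ∧ ∃ τ', M.Stable ABC τ' ∧ M.Leads (y :: w) τ τ' := by
  have hex : ∃ k, ∃ w, y :: w ∈ ABC ∧ ∃ q t s,
      M.Reach (τ.1, τ.2.1 :: cells (y :: w), [τ.2.2]) (q, [t], s) ∧ s.length = k := by
    obtain ⟨q, s, hq⟩ := exists_reach_tape_nil_of_stable hM hτ hx nil_mem_ABC h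
    have := hq.append [.symbol y] []
    exact ⟨_, [], cons_mem_ABC.2 ⟨hy, nil_mem_ABC⟩, q, .symbol y, s, by simpa using this, rfl⟩
  classical
  obtain ⟨w, hw, q, t, s, hq, hk⟩ := Nat.find_spec hex
  have hmin := fun k => Nat.find_min (m := k) hex
  obtain _ | ⟨b, s⟩ := s
  · exact (hτ _ hw _ _ hq).elim
  refine ⟨w, hw, (q, t, b), ?_, s, hq⟩
  intro v hv q' u h
  -- The pop may coincide with the head leaving `v`. The extra letter ensures that a cell is scanned
  -- after the pop, and the tape is then cut behind that cell.
  have hva : v ++ [Letter.a] ∈ ABC := append_mem_ABC.2 ⟨hv, replicate_mem_ABC 1⟩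
  have h1 := h.append [.symbol .a] []
  obtain ⟨z, u', hu⟩ := exists_cons_of_ne_nil (show u ++ [.symbol Letter.a] ≠ [] by simp)
  obtain ⟨pre, hpre⟩ := h1.isSuffix
  dsimp only at h1 hpre
  rw [hu] at h1 hpre
  have h2 : t :: cells (v ++ [Letter.a]) = (pre ++ [z]) ++ u' := by simp [hpre]
  have h3 : t :: cells ((v ++ [Letter.a]).take pre.length) = pre ++ [z] := by
    have := congrArg (take (pre.length + 1)) h2
    rw [take_left' (by simp)] at this
    rw [← this, take_succ_cons, cells, map_take]
  rw [← hpre, append_cons] at h1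
  have h4 := h1.truncate
  rw [← h3] at h4
  set v' := (v ++ [Letter.a]).take pre.length
  have hv' : v' ∈ ABC := take_mem_ABC hva _
  have h5 := h4.append [] s
  have h6 := hq.append (cells v') []
  simp only [append_nil, nil_append, cons_append, ← map_append] at h5 h6
  refine hmin s.length (by rw [← hk]; simp) ⟨w ++ v', ?_, _, _, _, h6.trans h5, rfl⟩
  rw [← cons_append]
  exact append_mem_ABC.2 ⟨hw, hv'⟩

/-- There are two words of equal length, with different first letters, that lead from a reachable
type back to itself. -/
theorem exists_leads_loops [Finite Q] [Finite Γ] (hM : M.Solves problemI) :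
    ∃ τ x A B, x ∈ ABC ∧ Letter.a :: A ∈ ABC ∧ Letter.b :: B ∈ ABC ∧ A.length = B.length ∧
      M.Leads x (startType M) τ ∧ M.Leads (.a :: A) τ τ ∧ M.Leads (.b :: B) τ τ := by
  obtain ⟨τ, ⟨⟨x, hx, hxτ⟩, hτ⟩, hrec⟩ := exists_recurrent
    (r := fun τ τ' => ∃ w ∈ ABC, M.Leads w τ τ')
    (fun τ => ⟨[], nil_mem_ABC, .refl τ⟩)
    (fun _ _ _ ⟨v, hv, h⟩ ⟨w, hw, h'⟩ => ⟨v ++ w, append_mem_ABC.2 ⟨hv, hw⟩, h.trans h'⟩)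
    (S := {τ | (∃ w ∈ ABC, M.Leads w (startType M) τ) ∧ M.Stable ABC τ})
    ⟨_, ⟨[], nil_mem_ABC, .refl _⟩, stable_startType⟩
  have loop : ∀ y, y = Letter.a ∨ y = .b ∨ y = .c → ∃ w, y :: w ∈ ABC ∧ M.Leads (y :: w) τ τ := by
    intro y hy
    obtain ⟨w, hw, τ', hτ', h⟩ := exists_leads_stable hM hτ hx hxτ hy
    obtain ⟨v, hv, h'⟩ := hrec τ'
      ⟨⟨_, append_mem_ABC.2 ⟨hx, hw⟩, hxτ.trans h⟩, hτ'⟩ ⟨_, hw, h⟩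
    exact ⟨w ++ v, append_mem_ABC.2 ⟨hw, hv⟩, h.trans h'⟩
  obtain ⟨u, hu, hul⟩ := loop .a (by simp)
  obtain ⟨v, hv, hvl⟩ := loop .b (by simp)
  -- Running the two loops in both orders makes the lengths equal.
  exact ⟨τ, x, u ++ .b :: v, v ++ .a :: u, hx, append_mem_ABC.2 ⟨hu, hv⟩, append_mem_ABC.2 ⟨hv, hu⟩,
    by simp; omega, hxτ, hul.trans hvl, hvl.trans hul⟩

/-! ### Pops below the type during the second and third words -/

/-- The part of the tape that is read while the second word is compared. -/
abbrev second (w : List Letter) : List (TapeSymbol Letter) := .symbol .hash :: cells w.reverse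

/-- The rest of the tape, with the third word. -/
abbrev third (w : List Letter) : List (TapeSymbol Letter) :=
  .symbol .hash :: cells w.reverse ++ [.rightEnd]

theorem exists_reach_start {τ : Q × TapeSymbol Letter × Γ} {y : List Letter}
    (h : M.Leads y (startType M) τ) : ∃ r, ∀ z w₂ w₃, M.Reach (start M (y ++ z) w₂ w₃)
      (τ.1, τ.2.1 :: cells z ++ second w₂ ++ third w₃, τ.2.2 :: r) := by
  obtain ⟨r, h⟩ := h
  refine ⟨r, fun z w₂ w₃ => ?_⟩
  have := h.append (cells z ++ second w₂ ++ third w₃) []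
  simpa [start, startType] using this

/-- The loop on `z` keeps the stack nonempty, so the pop comes after it. The bound does not mention
`z`, so the unread tapes for different loops are comparable by length alone. -/
theorem isSuffix_of_reach {τ : Q × TapeSymbol Letter × Γ} {z : List Letter}
    {v : List (TapeSymbol Letter)} (h : M.Leads z τ τ) {q u}
    (hq : M.Reach (τ.1, τ.2.1 :: cells z ++ v, [τ.2.2]) (q, u, [])) : u <:+ τ.2.1 :: v := by
  obtain ⟨s, h⟩ := h
  have := h.append v []
  rw [append_nil, append_nil] at this
  exact (this.of_terminal (fun _ => not_step_of_stack_nil) hq).isSuffix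

theorem eq_of_isSuffix_of_length {β : Type*} {u u' v : List β} (h : u <:+ v) (h' : u' <:+ v)
    (hl : u.length = u'.length) : u = u' :=
  (suffix_of_suffix_length_le h h' hl.le).eq_of_length hl

/-- A state and a head position in the second word at which the stack is popped below the top
symbol of the type `τ` determine the last part of the first word. -/
theorem eq_of_pop (hM : M.Solves problemI) {τ : Q × TapeSymbol Letter × Γ} {y z z' w : List Letter}
    (hy : y ∈ ABC) (hz : z ∈ ABC) (hz' : z' ∈ ABC) (hw : w ∈ ABC)
    (hyτ : M.Leads y (startType M) τ) (hzτ : M.Leads z τ τ) (hzτ' : M.Leads z' τ τ)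
    (hl : z.length = z'.length) (hwl : w.length = (y ++ z).length) {q u u'}
    (h : M.Reach (τ.1, τ.2.1 :: cells z ++ second w, [τ.2.2]) (q, u, []))
    (h' : M.Reach (τ.1, τ.2.1 :: cells z' ++ second w, [τ.2.2]) (q, u', []))
    (hu : u.length = u'.length) : z = z' := by
  obtain rfl := eq_of_isSuffix_of_length (isSuffix_of_reach hzτ h) (isSuffix_of_reach hzτ' h') hu
  by_contra hne
  have hyz : y ++ z ∈ ABC := append_mem_ABC.2 ⟨hy, hz⟩
  have hyz' : y ++ z' ∈ ABC := append_mem_ABC.2 ⟨hy, hz'⟩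
  have hll : (y ++ z).length = (y ++ z').length := by simp [hl]
  -- The third word is chosen so that the two inputs have different answers, although both
  -- computations continue from the same configuration.
  obtain ⟨v, hv, hvl, hodd⟩ := exists_odd_diffCount_iff
    (¬ Odd (diffCount (y ++ z) w + diffCount (y ++ z') w)) hyz hyz' hll (by simpa using hne)
  obtain ⟨r, hr⟩ := exists_reach_start hyτ
  have := odd_iff_odd_of_reach hM hyz hw hv hwl hvl hyz' hw hv (hwl.trans hll) (hvl.trans hll)
    ((hr z w v).trans (h.append (third v) r)) ((hr z' w v).trans (h'.append (third v) r))
    (.inr ⟨rfl, rfl⟩)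
  rw [Nat.odd_iff, Nat.odd_iff] at this hodd
  omega

/-- The computation starts from the stack top of `τ` alone, so its outcome is the same for every `y`
that leads to `τ`. -/
theorem exists_reach_halt_or_pop (hM : M.Solves problemI) {τ : Q × TapeSymbol Letter × Γ}
    {y z w v : List Letter} (hyz : y ++ z ∈ ABC) (hw : w ∈ ABC) (hv : v ∈ ABC)
    (hyτ : M.Leads y (startType M) τ) (hwl : w.length = (y ++ z).length)
    (hvl : v.length = (y ++ z).length)
    (hpop : ¬ ∃ q u, M.Reach (τ.1, τ.2.1 :: cells z ++ second w, [τ.2.2]) (q, u, [])) :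
    ∃ q u s, M.Reach (τ.1, τ.2.1 :: cells z ++ second w ++ third v, [τ.2.2]) (q, u, s) ∧
      (q ∈ M.acc ∪ M.rej ∨ s = [] ∧ u <:+ third v) := by
  obtain ⟨d, hd, hh, -⟩ := exists_reach_halt hM hyz hw hv hwl hvl
  obtain ⟨r, hr⟩ := exists_reach_start hyτ
  replace hd := (hr z w v).of_terminal (fun _ => not_step_of_halt hh) hd
  rcases Reach.stack_split (s := [τ.2.2]) hd with ⟨q, u, s, rfl, h⟩ | ⟨q, u, h, -⟩
  · exact ⟨q, u, s, h, .inl hh⟩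
  · refine ⟨q, u, [], h, .inr ⟨rfl, ?_⟩⟩
    rcases h.tape_split with ⟨q', u', s', he, h'⟩ | ⟨q', s', -, h'⟩
    · simp only [Prod.mk.injEq] at he
      obtain ⟨rfl, rfl, rfl⟩ := he
      exact (hpop ⟨_, _, h'⟩).elim
    · exact h'.isSuffix

end Machine

/-! ### Counting and the final contradiction -/

theorem exists_mul_lt_two_pow (c d e : ℕ) : ∃ m, c * (d + e * m) < 2 ^ m := by
  set t := c + d + e + 5 with ht
  refine ⟨4 * t, ?_⟩
  have h1 : t ^ 4 < 2 ^ (4 * t) := by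
    rw [mul_comm, pow_mul]
    exact Nat.pow_lt_pow_left t.lt_two_pow_self (by simp)
  refine lt_of_le_of_lt ?_ h1
  calc c * (d + e * (4 * t)) ≤ t * (t * t + t * (4 * t)) := by
        gcongr
        · omega
        · nlinarith
        · omega
    _ = 5 * t ^ 3 := by ring
    _ ≤ t * t ^ 3 := by gcongr; omega
    _ = t ^ 4 := by ring

end ProblemI

open DPDA ProblemI in
theorem theorem4 {Q Γ : Type*} [Finite Q] [Finite Γ] (M : DPDA Q Letter Γ) :
    ¬ M.Solves problemI := by
  intro hM
  obtain ⟨τ, x, A, B, hx, hA, hB, hAB, hxτ, hAτ, hBτ⟩ := exists_leads_loops hM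
  set k := A.length with hk
  set f : Bool → List Letter := fun i => bif i then .a :: A else .b :: B with hf
  set g : Bool → List Letter := fun i => (bif i then .a else .c) :: replicate k .a with hg
  have hfτ : ∀ i, M.Leads (f i) τ τ := by rintro (_ | _) <;> assumption
  have hfA : ∀ i, f i ∈ ABC := by rintro (_ | _) <;> assumption
  have hgA : ∀ i, g i ∈ ABC := by
    rintro (_ | _) <;> exact cons_mem_ABC.2 ⟨by simp, replicate_mem_ABC k⟩
  have hfl : ∀ i, (f i).length = k + 1 := by rintro (_ | _) <;> simp [hf, ← hAB, ← hk]
  have hgl : ∀ i, (g i).length = k + 1 := by simp [hg]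
  have hfi : Function.Injective f := by rintro (_ | _) (_ | _) <;> simp [hf]
  have : Fintype Q := Fintype.ofFinite Q
  obtain ⟨m, hm⟩ := exists_mul_lt_two_pow (Fintype.card Q) (3 * x.length + 6) (9 * (k + 1))
  set n := x.length + (m * (k + 1) + 2 * m * (k + 1)) with hn
  set N := 3 * x.length + 6 + 9 * (k + 1) * m with hN
  have hNn : 3 * n + 6 = N := by rw [hn, hN]; ring
  -- The code of `t` is aligned with the loops of `e`. The parts `x` and `e'` face only the letter
  -- `a`, so their share of the distance does not depend on `t`.
  let W (t : List.Vector Bool m) : List Letter :=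
    replicate x.length .a ++ (t.1.flatMap g ++ replicate (2 * m * (k + 1)) .a)
  have hWl : ∀ t, (W t).length = n := fun t => by
    simp [W, length_flatMap_of_forall hgl, hn, t.2]
  have hWA : ∀ t, W t ∈ ABC := fun t => by
    simp only [W, append_mem_ABC, replicate_mem_ABC, flatMap_mem_ABC hgA, true_and]
  have hel : ∀ {j} (e : List.Vector Bool j), (e.1.flatMap f).length = j * (k + 1) := fun e => by
    rw [length_flatMap_of_forall hfl, e.2]
  have hyτ : ∀ e : List Bool, M.Leads (x ++ e.flatMap f) (startType M) τ :=
    fun e => hxτ.trans (.flatMap hfτ e)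
  have hyA : ∀ e : List Bool, x ++ e.flatMap f ∈ ABC :=
    fun e => append_mem_ABC.2 ⟨hx, flatMap_mem_ABC hfA e⟩
  have hyl : ∀ (e : List.Vector Bool m) (e' : List.Vector Bool (2 * m)),
      ((x ++ e.1.flatMap f) ++ e'.1.flatMap f).length = n := fun e e' => by
    simp only [length_append, hel, hn, add_assoc]
  -- Any fixed `e` will do: it only supplies a complete input, and the pops and outcomes below are
  -- stated from `τ` on.
  have e₀ : List.Vector Bool m := List.Vector.replicate m true
  -- some last part of the first word is not popped while the second word is read
  have hgood : ∃ e' : List.Vector Bool (2 * m), ∀ t, ¬ ∃ q u,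
      M.Reach (τ.1, τ.2.1 :: cells (e'.1.flatMap f) ++ second (W t), [τ.2.2]) (q, u, []) := by
    by_contra! hbad
    choose t q u hu using hbad
    have hul : ∀ e', (u e').length < N := fun e' => by
      have := (isSuffix_of_reach (.flatMap hfτ _) (hu e')).length_le
      simp [hWl] at this
      omega
    obtain ⟨e₁, e₂, hne, he⟩ := Fintype.exists_ne_map_eq_of_card_lt
      -- By `hm` there are fewer than `2 ^ m * 2 ^ m` triples of a second word, a state and a
      -- position.
      (fun e' => (t e', q e', (⟨_, hul e'⟩ : Fin N))) (by
        simp only [Fintype.card_prod, card_vector, Fintype.card_bool, Fintype.card_fin]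
        rw [two_mul m, pow_add]
        gcongr)
    simp only [Prod.mk.injEq, Fin.mk.injEq] at he
    obtain ⟨ht, hq, hl⟩ := he
    have h₁ := hu e₁
    have h₂ := hu e₂
    rw [ht, hq] at h₁
    refine hne (Subtype.ext (flatMap_injective_of_forall hfl hfi (e₁.2.trans e₂.2.symm) ?_))
    exact eq_of_pop hM (hyA e₀.1) (flatMap_mem_ABC hfA _) (flatMap_mem_ABC hfA _) (hWA _) (hyτ e₀.1)
      (.flatMap hfτ _) (.flatMap hfτ _) (by rw [hel, hel]) (by rw [hWl, hyl]) h₁ h₂ hl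
  obtain ⟨e', he'⟩ := hgood
  have hyA' : ∀ e : List Bool, (x ++ e.flatMap f) ++ e'.1.flatMap f ∈ ABC :=
    fun e => append_mem_ABC.2 ⟨hyA e, flatMap_mem_ABC hfA _⟩
  -- two second words lead to the same outcome, whatever the first part of the first word is
  have hout := fun t => exists_reach_halt_or_pop hM (hyA' e₀.1) (hWA t) (replicate_mem_ABC n)
    (hyτ e₀.1) (by rw [hWl, hyl]) (by rw [length_replicate, hyl]) (he' t)
  choose q u s hr ho using hout
  have hul : ∀ t, (u t).length < N := fun t => by
    have := (hr t).isSuffix.length_le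
    have h : 2 * m * (k + 1) ≤ n := by omega
    simp only [length_append, length_cons, length_map, hel, length_reverse, hWl, length_replicate,
      length_nil] at this
    omega
  obtain ⟨t₁, t₂, hne, he⟩ := Fintype.exists_ne_map_eq_of_card_lt
    (fun t => (q t, (⟨_, hul t⟩ : Fin N))) (by
      simpa only [Fintype.card_prod, card_vector, Fintype.card_bool, Fintype.card_fin] using hm)
  simp only [Prod.mk.injEq, Fin.mk.injEq] at he
  obtain ⟨hq, hl⟩ := he
  obtain ⟨e, hel', hodd⟩ := exists_odd_diffCount_ne rfl hAB.symm (t₁.2.trans t₂.2.symm)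
    (fun h => hne (Subtype.ext h))
  obtain ⟨e, rfl⟩ : ∃ e₁ : List.Vector Bool m, e₁.1 = e := ⟨⟨e, hel'.trans t₁.2⟩, rfl⟩
  obtain ⟨r, hs⟩ := exists_reach_start (hyτ e.1)
  have hreach : ∀ t, M.Reach (start M ((x ++ e.1.flatMap f) ++ e'.1.flatMap f) (W t)
      (replicate n .a)) (q t, u t, s t ++ r) := fun t => (hs _ _ _).trans (by
    simpa only [append_nil, cons_append, nil_append] using (hr t).append [] r)
  -- Either the common state halts, or both computations have popped down to `r`. In the latter case
  -- both unread tapes are suffixes of the same third part, so equal lengths make them equal.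
  have hsame : q t₁ ∈ M.acc ∪ M.rej ∨ u t₁ = u t₂ ∧ s t₁ ++ r = s t₂ ++ r := by
    rcases ho t₁ with h | ⟨hs₁, hu₁⟩
    · exact .inl h
    · rcases ho t₂ with h | ⟨hs₂, hu₂⟩
      · exact .inl (hq ▸ h)
      · exact .inr ⟨eq_of_isSuffix_of_length hu₁ hu₂ hl, by rw [hs₁, hs₂]⟩
  have hdiff : ∀ t : List.Vector Bool m, diffCount ((x ++ e.1.flatMap f) ++ e'.1.flatMap f) (W t) =
      diffCount x (replicate x.length .a) + (diffCount (e.1.flatMap f) (t.1.flatMap g) +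
        diffCount (e'.1.flatMap f) (replicate (2 * m * (k + 1)) .a)) := fun t => by
    rw [append_assoc, diffCount_append (by simp), diffCount_append (by
      rw [hel, length_flatMap_of_forall hgl, t.2])]
  have hpar := odd_iff_odd_of_reach hM (hyA' _) (hWA t₁) (replicate_mem_ABC n) (by rw [hWl, hyl])
    (by rw [length_replicate, hyl]) (hyA' _) (hWA t₂) (replicate_mem_ABC n) (by rw [hWl, hyl])
    (by rw [length_replicate, hyl]) (hreach t₁) (hq ▸ hreach t₂) hsame
  rw [hdiff, hdiff] at hpar
  apply hodd
  rw [Nat.odd_iff, Nat.odd_iff] at hpar ⊢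
  change (diffCount (e.1.flatMap f) (t₁.1.flatMap g)) % 2 = 1 ↔
    (diffCount (e.1.flatMap f) (t₂.1.flatMap g)) % 2 = 1
  omega
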